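/- Let $X\neq\emptyset$ be a countable set and let $b:X\times X\to[0,\infty)$ be a symmetric edge weight with $b(x,x)=0$ and $\sum_{z}b(x,z)<\infty$ for all $x\in X$. Let $\mu:X\to(0,\infty)$ and $V:X\to\mathbb{R}$, and let $\ell^2(X,\mu)$ be the Hilbert space of functions $f:X\to\mathbb{C}$ with $\sum_x|f(x)|^2\mu(x)<\infty$, with inner product $\langle f,g\rangle=\sum_x\overline{f(x)}g(x)\mu(x)$. The formal Schrödinger operator is $$\mathcal{H}f(x)=\frac1{\mu(x)}\sum_{y\in X}b(x,y)(f(x)-f(y))+V(x)f(x),$$ defined for $f\in\mathcal{F}=\{f:X\to\mathbb{C}\mid \sum_{y}b(x,y)|f(y)|<\infty\text{ for all }x\in X\}$. Let $\mathcal{Q}^c$ be the form $$\mathcal{Q}^c(f,g)=\frac12\sum_{x,y\in X}b(x,y)\overline{(f(x)-f(y))}(g(x)-g(y))+\sum_{x\in X}V(x)\overline{f(x)}g(x)\mu(x)$$ with domain $C_c(X)$, the space of finitely supported complex-valued functions on $X$. **Theorem.** Suppose that $V$ is admissible, i.e. that $\mathcal{Q}^c$ is lower semi-bounded on $\ell^2(X,\mu)$: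 there is $C\in\mathbb{R}$ with $C\|f\|^2\le\mathcal{Q}^c(f,f)$ for all $f\in C_c(X)$. Then $\mathcal{Q}^c$ is lower semi-bounded and closable on $\ell^2(X,\mu)$. Let $Q^0$ be its closure and let $H^0$ be the operator associated with $Q^0$, i.e. $f\in D(H^0)$ and $H^0f=g$ if and only if $f\in D(Q^0)$, $g\in\ell^2(X,\mu)$ and $Q^0(f,h)=\langle g,h\rangle$ for all $h\in D(Q^0)$. Then $H^0$ is a realization of $\mathcal{H}$, that is: $H^0$ is self-adjoint and bounded from below, the domain of the quadratic form of $H^0$ contains $C_c(X)$, and $D(H^0)\subseteq\mathcal{F}$ with $H^0f=\mathcal{H}f$ for all $f\in D(H^0)$. Moreover, $Q^0$ satisfies the first Beurling–Deny criterion: $f\in D(Q^0)$ implies $|f|\in D(Q^0)$ and $Q^0(|f|)\le Q^0(f)$, where $Q^0(f)=Q^0(f,f)$. -/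

import Mathlib

open Filter Topology
open scoped ComplexConjugate

noncomputable section

namespace DiscreteSchrodinger

/-! ### Closed quadratic forms on Hilbert spaces -/

section Forms

variable {H : Type*} [NormedAddCommGroup H] [InnerProductSpace ℂ H]

/-- A quadratic form on (a subspace of) a complex Hilbert space, given by its domain and its
sesquilinear Hermitian form (antilinear in the first, linear in the second argument). -/
structure HermForm (H : Type*) [NormedAddCommGroup H] [InnerProductSpace ℂ H] where
  /-- The domain `D(q)`. -/
  domain : Submodule ℂ H
  /-- The induced sesquilinear form on `D(q)`. -/
  form : domain →ₗ⋆[ℂ] domain →ₗ[ℂ] ℂ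
  conj_form : ∀ f g, conj (form f g) = form g f

namespace HermForm

/-- The (real) value `q(f) = q(f, f)`. -/
def quad (q : HermForm H) (f : q.domain) : ℝ := (q.form f f).re

def IsLowerBound (q : HermForm H) (C : ℝ) : Prop :=
  ∀ f : q.domain, C * ‖(f : H)‖ ^ 2 ≤ q.quad f

def IsLowerSemibounded (q : HermForm H) : Prop := ∃ C : ℝ, q.IsLowerBound C

/-- `λ₀(q)`, the largest lower bound of a lower semi-bounded form. -/
def lambda0 (q : HermForm H) : ℝ := sSup {C : ℝ | q.IsLowerBound C}

/-- The square of the form norm, `‖f‖_q² = q(f) + (1 - λ₀(q)) ‖f‖²`. -/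
def formNormSq (q : HermForm H) (f : q.domain) : ℝ :=
  q.quad f + (1 - q.lambda0) * ‖(f : H)‖ ^ 2

/-- A densely defined lower semi-bounded form is closed if its domain is complete with respect to
the form norm. -/
structure IsClosedForm (q : HermForm H) : Prop where
  dense : Dense (q.domain : Set H)
  lowerSemibounded : q.IsLowerSemibounded
  complete : ∀ u : ℕ → q.domain,
    (∀ ε > 0, ∃ N, ∀ m ≥ N, ∀ n ≥ N, q.formNormSq (u m - u n) < ε) →
      ∃ f : q.domain, Tendsto (fun n => q.formNormSq (u n - f)) atTop (𝓝 0)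

/-- `q'` is an extension of `q`. -/
def IsExtensionOf (q' q : HermForm H) : Prop :=
  ∃ h : q.domain ≤ q'.domain, ∀ f g : q.domain,
    q'.form (Submodule.inclusion h f) (Submodule.inclusion h g) = q.form f g

/-- A form is closable if it possesses a closed extension. -/
def IsClosable (q : HermForm H) : Prop :=
  ∃ q' : HermForm H, q'.IsClosedForm ∧ q'.IsExtensionOf q

/-- `q'` is the closure of `q`: a closed extension of `q` in whose domain `D(q)` is dense with
respect to the form norm of `q'`. -/
structure IsClosureOf (q' q : HermForm H) : Prop where
  closed : q'.IsClosedForm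
  extension : q'.IsExtensionOf q
  form_dense : ∀ f : q'.domain, ∃ u : ℕ → q'.domain, (∀ n, (u n : H) ∈ q.domain) ∧
    Tendsto (fun n => q'.formNormSq (u n - f)) atTop (𝓝 0)

open Classical in
/-- The closure of a form (by convention `q` itself if `q` has no closure). -/
def closure (q : HermForm H) : HermForm H :=
  if h : ∃ q' : HermForm H, q'.IsClosureOf q then h.choose else q

/-- The graph of the operator associated with `q`: all pairs `(f, g)` with `f ∈ D(q)` and
`q(f, h) = ⟨g, h⟩` for all `h ∈ D(q)`. -/
def operatorGraph (q : HermForm H) : Submodule ℂ (H × H) where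
  carrier := {p | ∃ hf : p.1 ∈ q.domain, ∀ h : q.domain,
    q.form ⟨p.1, hf⟩ h = inner ℂ p.2 (h : H)}
  add_mem' := by
    rintro ⟨f, g⟩ ⟨f', g'⟩ ⟨hf, h⟩ ⟨hf', h'⟩
    refine ⟨q.domain.add_mem hf hf', fun k => ?_⟩
    have e : (⟨((f, g) + (f', g')).1, q.domain.add_mem hf hf'⟩ : q.domain)
        = ⟨f, hf⟩ + ⟨f', hf'⟩ := rfl
    rw [e, map_add, LinearMap.add_apply, h k, h' k]
    exact (inner_add_left _ _ _).symm
  zero_mem' := by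
    refine ⟨q.domain.zero_mem, fun k => ?_⟩
    have e : (⟨(0 : H × H).1, q.domain.zero_mem⟩ : q.domain) = 0 := rfl
    rw [e, map_zero]
    simp
  smul_mem' := by
    rintro c ⟨f, g⟩ ⟨hf, h⟩
    refine ⟨q.domain.smul_mem c hf, fun k => ?_⟩
    have e : (⟨(c • (f, g)).1, q.domain.smul_mem c hf⟩ : q.domain) = c • ⟨f, hf⟩ := rfl
    rw [e, LinearMap.map_smulₛₗ, LinearMap.smul_apply, h k]
    exact (inner_smul_left _ _ _).symm

/-- The operator associated with a densely defined form. -/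
def operator (q : HermForm H) : H →ₗ.[ℂ] H := q.operatorGraph.toLinearPMap

end HermForm

end Forms

/-! ### Weighted graphs and weighted `ℓ²`-spaces -/

/-- A symmetric weighted graph `(X, b)`. -/
structure WeightedGraph (X : Type*) where
  b : X → X → ℝ
  nonneg : ∀ x y, 0 ≤ b x y
  loopless : ∀ x, b x x = 0
  symm : ∀ x y, b x y = b y x
  summable : ∀ x, Summable (b x)

/-- A strictly positive function on `X`. -/
structure Weight (X : Type*) where
  val : X → ℝ
  pos : ∀ x, 0 < val x

variable {X : Type*}

instance : CoeFun (Weight X) (fun _ => X → ℝ) := ⟨Weight.val⟩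

/-- The square summable functions as a subspace of all functions `X → ℂ`. -/
def l2Submodule (μ : Weight X) : Submodule ℂ (X → ℂ) where
  carrier := {f | Summable fun x => ‖f x‖ ^ 2 * μ x}
  add_mem' := by
    intro f g hf hg
    refine Summable.of_nonneg_of_le (fun x => mul_nonneg (sq_nonneg _) (μ.pos x).le)
      (fun x => ?_) ((hf.add hg).mul_left 2)
    have h1 : ‖(f + g) x‖ ^ 2 ≤ 2 * (‖f x‖ ^ 2 + ‖g x‖ ^ 2) := by
      have := norm_add_le (f x) (g x)
      rw [Pi.add_apply]
      nlinarith [norm_nonneg (f x + g x), sq_nonneg (‖f x‖ - ‖g x‖)]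
    calc ‖(f + g) x‖ ^ 2 * μ x ≤ 2 * (‖f x‖ ^ 2 + ‖g x‖ ^ 2) * μ x :=
          mul_le_mul_of_nonneg_right h1 (μ.pos x).le
      _ = 2 * (‖f x‖ ^ 2 * μ x + ‖g x‖ ^ 2 * μ x) := by ring
  zero_mem' := by simp [summable_zero]
  smul_mem' := by
    intro c f hf
    refine (Summable.mul_left (‖c‖ ^ 2) hf).congr fun x => ?_
    simp only [Pi.smul_apply, norm_smul]
    ring

/-- The space `ℓ²(X, μ)` of complex-valued functions `f` with `∑ |f(x)|² μ(x) < ∞`. -/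
def L2 (μ : Weight X) : Type _ := l2Submodule μ

namespace L2

variable {μ : Weight X}

instance : AddCommGroup (L2 μ) := inferInstanceAs (AddCommGroup (l2Submodule μ))
instance : Module ℂ (L2 μ) := inferInstanceAs (Module ℂ (l2Submodule μ))
instance : CoeFun (L2 μ) (fun _ => X → ℂ) := ⟨fun f => f.1⟩

/-- A square summable function as an element of `ℓ²(X, μ)`. -/
def mk (f : X → ℂ) (hf : Summable fun x => ‖f x‖ ^ 2 * μ x) : L2 μ := ⟨f, hf⟩

@[simp] theorem mk_apply (f : X → ℂ) (hf : Summable fun x => ‖f x‖ ^ 2 * μ x) (x : X) :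
    (mk f hf : L2 μ) x = f x := rfl

@[ext] theorem ext {f g : L2 μ} (h : ∀ x, f x = g x) : f = g := Subtype.ext (funext h)

@[simp] theorem add_apply (f g : L2 μ) (x : X) : (f + g) x = f x + g x := rfl
@[simp] theorem sub_apply (f g : L2 μ) (x : X) : (f - g) x = f x - g x := rfl
@[simp] theorem zero_apply (x : X) : (0 : L2 μ) x = 0 := rfl
@[simp] theorem smul_apply (c : ℂ) (f : L2 μ) (x : X) : (c • f) x = c * f x := rfl

theorem summable_sq (f : L2 μ) : Summable fun x => ‖f x‖ ^ 2 * μ x := f.2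

theorem summable_inner (f g : L2 μ) : Summable fun x => conj (f x) * g x * (μ x : ℂ) := by
  refine Summable.of_norm_bounded (f.summable_sq.add g.summable_sq) fun x => ?_
  rw [norm_mul, norm_mul, RCLike.norm_conj, Complex.norm_real, Real.norm_of_nonneg (μ.pos x).le,
    ← add_mul]
  refine mul_le_mul_of_nonneg_right ?_ (μ.pos x).le
  nlinarith [sq_nonneg (‖f x‖ - ‖g x‖), sq_nonneg (‖f x‖), sq_nonneg (‖g x‖)]

/-- The inner product `⟨f, g⟩ = ∑ conj (f x) * g x * μ x`. -/
def innerProd (f g : L2 μ) : ℂ := ∑' x, conj (f x) * g x * (μ x : ℂ)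

theorem innerProd_self (f : L2 μ) :
    innerProd f f = ((∑' x, ‖f x‖ ^ 2 * μ x : ℝ) : ℂ) := by
  rw [innerProd, Complex.ofReal_tsum]
  refine tsum_congr fun x => ?_
  rw [Complex.conj_mul']
  push_cast
  rfl

instance core : InnerProductSpace.Core ℂ (L2 μ) where
  inner := innerProd
  conj_inner_symm f g := by
    simp only [innerProd]
    rw [Complex.conj_tsum]
    refine tsum_congr fun x => ?_
    simp only [map_mul, Complex.conj_conj, Complex.conj_ofReal]
    ring
  re_inner_nonneg f := by
    change 0 ≤ (innerProd f f).re
    rw [innerProd_self, Complex.ofReal_re]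
    exact tsum_nonneg fun x => mul_nonneg (sq_nonneg _) (μ.pos x).le
  add_left f g h := by
    change innerProd (f + g) h = innerProd f h + innerProd g h
    simp only [innerProd]
    rw [← (summable_inner f h).tsum_add (summable_inner g h)]
    refine tsum_congr fun x => ?_
    simp only [add_apply, map_add]
    ring
  smul_left f g c := by
    change innerProd (c • f) g = conj c * innerProd f g
    simp only [innerProd]
    rw [← tsum_mul_left]
    refine tsum_congr fun x => ?_
    simp only [smul_apply, map_mul]
    ring
  definite f hf := by
    change innerProd f f = 0 at hf
    rw [innerProd_self, Complex.ofReal_eq_zero] at hf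
    have h0 := (hasSum_zero_iff_of_nonneg
      (fun x => mul_nonneg (sq_nonneg ‖f x‖) (μ.pos x).le)).1 (hf ▸ f.summable_sq.hasSum)
    ext x
    have hx := congrFun h0 x
    simpa [(μ.pos x).ne'] using hx

instance : NormedAddCommGroup (L2 μ) := core.toNormedAddCommGroup
instance : InnerProductSpace ℂ (L2 μ) := InnerProductSpace.ofCore core.toCore

theorem inner_def (f g : L2 μ) : inner ℂ f g = ∑' x, conj (f x) * g x * (μ x : ℂ) := rfl

theorem norm_sq_eq (f : L2 μ) : ‖f‖ ^ 2 = ∑' x, ‖f x‖ ^ 2 * μ x := by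
  rw [← inner_self_eq_norm_sq (𝕜 := ℂ) f]
  change (innerProd f f).re = _
  rw [innerProd_self, Complex.ofReal_re]

/-- Multiplication by `√μ` is a unitary map from `ℓ²(X, μ)` onto the unweighted `ℓ²(X)`. -/
def toLp (μ : Weight X) : L2 μ ≃ₗᵢ[ℂ] lp (fun _ : X => ℂ) 2 where
  toFun f := ⟨fun x => (Real.sqrt (μ x) : ℂ) * f x, by
    refine memℓp_gen (f.summable_sq.congr fun x => ?_)
    simp [mul_pow, Real.sq_sqrt (μ.pos x).le, Complex.norm_real, mul_comm]⟩
  invFun g := mk (fun x => (Real.sqrt (μ x) : ℂ)⁻¹ * g x) (by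
    refine ((lp.memℓp g).summable (by norm_num)).congr fun x => ?_
    have := (μ.pos x).ne'
    simp [mul_pow, Real.sq_sqrt (μ.pos x).le, Complex.norm_real]
    field_simp)
  left_inv f := by
    ext x
    have : (Real.sqrt (μ x) : ℂ) ≠ 0 := by
      exact_mod_cast (Real.sqrt_pos.2 (μ.pos x)).ne'
    simp [this]
  right_inv g := by
    ext x
    have : (Real.sqrt (μ x) : ℂ) ≠ 0 := by
      exact_mod_cast (Real.sqrt_pos.2 (μ.pos x)).ne'
    simp [this]
  map_add' f g := by
    ext x
    exact mul_add (Real.sqrt (μ x) : ℂ) (f x) (g x)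
  map_smul' c f := by
    ext x
    simp [mul_left_comm]
  norm_map' f := by
    refine (sq_eq_sq₀ (norm_nonneg _) (norm_nonneg _)).1 ?_
    rw [norm_sq_eq]
    have h := lp.norm_rpow_eq_tsum (p := 2) (by norm_num)
      (⟨fun x => (Real.sqrt (μ x) : ℂ) * f x, by
        refine memℓp_gen (f.summable_sq.congr fun x => ?_)
        simp [mul_pow, Real.sq_sqrt (μ.pos x).le, Complex.norm_real, mul_comm]⟩ :
        lp (fun _ : X => ℂ) 2)
    simp only [ENNReal.toReal_ofNat, Real.rpow_ofNat] at h
    refine h.trans (tsum_congr fun x => ?_)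
    simp [mul_pow, Real.sq_sqrt (μ.pos x).le, Complex.norm_real, mul_comm]

instance : CompleteSpace (L2 μ) :=
  (toLp μ).toIsometryEquiv.completeSpace

/-- The pointwise absolute value `|f|`. -/
def abs (f : L2 μ) : L2 μ := mk (fun x => (‖f x‖ : ℂ)) (by simpa using f.summable_sq)

end L2

/-- The subspace `C_c(X)` of finitely supported functions of `ℓ²(X, μ)`. -/
def finSupp (μ : Weight X) : Submodule ℂ (L2 μ) where
  carrier := {f | (Function.support f).Finite}
  add_mem' := by
    intro f g hf hg
    exact (hf.union hg).subset (Function.support_add (f : X → ℂ) g)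
  zero_mem' := by
    change (Function.support (fun _ : X => (0 : ℂ))).Finite
    simp
  smul_mem' := by
    intro c f hf
    exact hf.subset (Function.support_const_smul_subset c (f : X → ℂ))

/-! ### Schrödinger operators and forms -/

section Schrodinger

variable (G : WeightedGraph X) (μ : Weight X) (V : X → ℝ)

/-- The domain `𝓕` of the formal Schrödinger operator. -/
def formalDomain : Set (X → ℂ) := {f | ∀ x, Summable fun y => G.b x y * ‖f y‖}

/-- The formal Schrödinger operator `𝓗`, meaningful on `formalDomain G`. -/
def formalOperator (f : X → ℂ) (x : X) : ℂ :=
  1 / (μ x : ℂ) * (∑' y, (G.b x y : ℂ) * (f x - f y)) + (V x : ℂ) * f x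

/-- The Schrödinger form `𝓠(f, g)` as a formula. -/
def energy (f g : X → ℂ) : ℂ :=
  1 / 2 * (∑' p : X × X, (G.b p.1 p.2 : ℂ) * (conj (f p.1 - f p.2) * (g p.1 - g p.2)))
    + ∑' x, (V x : ℂ) * conj (f x) * g x * (μ x : ℂ)

theorem summable_edge {f g : X → ℂ} (hf : f.support.Finite) (hg : g.support.Finite) :
    Summable fun p : X × X =>
      (G.b p.1 p.2 : ℂ) * (conj (f p.1 - f p.2) * (g p.1 - g p.2)) := by
  obtain ⟨M, hM⟩ : ∃ M : ℝ, ∀ x, ‖g x‖ ≤ M := by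
    obtain ⟨M, hM⟩ := (hg.image (fun x => ‖g x‖)).bddAbove
    refine ⟨max M 0, fun x => ?_⟩
    by_cases hx : g x = 0
    · simp [hx]
    · exact (hM (Set.mem_image_of_mem (fun x => ‖g x‖) hx)).trans (le_max_left _ _)
  have h1 : Summable fun p : X × X => G.b p.1 p.2 * ‖f p.1‖ := by
    have h0 : 0 ≤ fun p : X × X => G.b p.1 p.2 * ‖f p.1‖ :=
      fun p => mul_nonneg (G.nonneg p.1 p.2) (norm_nonneg (f p.1))
    rw [summable_prod_of_nonneg h0]
    refine ⟨fun x => (G.summable x).mul_right ‖f x‖, ?_⟩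
    refine summable_of_hasFiniteSupport (hf.subset fun x hx hx0 => hx ?_)
    simp [hx0]
  have h2 : Summable fun p : X × X => G.b p.1 p.2 * ‖f p.2‖ := by
    refine ((Equiv.prodComm X X).summable_iff.2 h1).congr fun p => ?_
    simp [G.symm p.2 p.1]
  refine Summable.of_norm_bounded ((h1.add h2).mul_right (2 * M)) fun p => ?_
  rw [norm_mul, norm_mul, RCLike.norm_conj, Complex.norm_real,
    Real.norm_of_nonneg (G.nonneg _ _), ← mul_add, mul_assoc]
  refine mul_le_mul_of_nonneg_left ?_ (G.nonneg _ _)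
  refine mul_le_mul (norm_sub_le _ _) ?_ (norm_nonneg _) (by positivity)
  linarith [norm_sub_le (g p.1) (g p.2), hM p.1, hM p.2]

theorem summable_potential {f : X → ℂ} (hf : f.support.Finite) (g : X → ℂ) :
    Summable fun x => (V x : ℂ) * conj (f x) * g x * (μ x : ℂ) := by
  refine summable_of_hasFiniteSupport (hf.subset fun x hx hx0 => hx ?_)
  simp [hx0]

theorem conj_energy (f g : X → ℂ) : conj (energy G μ V f g) = energy G μ V g f := by
  simp only [energy]
  rw [map_add, map_mul, Complex.conj_tsum, Complex.conj_tsum]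
  have h2 : conj (1 / 2 : ℂ) = 1 / 2 := by simp [Complex.conj_ofNat]
  rw [h2]
  congr 2
  · refine tsum_congr fun p => ?_
    simp only [map_sub, map_mul, Complex.conj_conj, Complex.conj_ofReal]
    ring
  · funext x
    simp only [map_mul, Complex.conj_conj, Complex.conj_ofReal]
    ring

theorem energy_add_right {f g g' : X → ℂ} (hf : f.support.Finite) (hg : g.support.Finite)
    (hg' : g'.support.Finite) :
    energy G μ V f (fun x => g x + g' x) = energy G μ V f g + energy G μ V f g' := by
  simp only [energy]
  rw [add_add_add_comm, ← mul_add,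
    ← (summable_edge G hf hg).tsum_add (summable_edge G hf hg'),
    ← (summable_potential μ V hf g).tsum_add (summable_potential μ V hf g')]
  congr 2
  · refine tsum_congr fun p => ?_
    ring
  · funext x
    ring

theorem energy_smul_right (c : ℂ) (f g : X → ℂ) :
    energy G μ V f (fun x => c * g x) = c * energy G μ V f g := by
  simp only [energy]
  rw [mul_add, mul_left_comm, ← tsum_mul_left (a := c), ← tsum_mul_left (a := c)]
  congr 2
  · refine tsum_congr fun p => ?_
    ring
  · funext x
    ring

/-- The Schrödinger form `𝓠ᶜ` on `C_c(X)`, regarded as a form on `ℓ²(X, μ)`. -/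
def Qc : HermForm (L2 μ) where
  domain := finSupp μ
  form := LinearMap.mk₂'ₛₗ (starRingEnd ℂ) (RingHom.id ℂ)
    (fun f g => energy G μ V (f : L2 μ) (g : L2 μ))
    (fun f f' g => by
      rw [← conj_energy, ← conj_energy G μ V (g : L2 μ) (f : L2 μ),
        ← conj_energy G μ V (g : L2 μ) (f' : L2 μ), ← map_add]
      exact congrArg _ (energy_add_right G μ V g.2 f.2 f'.2))
    (fun c f g => by
      rw [← conj_energy, ← conj_energy G μ V (g : L2 μ) (f : L2 μ), smul_eq_mul, ← map_mul]
      exact congrArg _ (energy_smul_right G μ V c _ _))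
    (fun f g g' => energy_add_right G μ V f.2 g.2 g'.2)
    (fun c f g => energy_smul_right G μ V c _ _)
  conj_form f g := conj_energy G μ V _ _

/-- `V` is an admissible potential. -/
def IsAdmissible : Prop := (Qc G μ V).IsLowerSemibounded

/-- `Q⁰`, the closure of `𝓠ᶜ` on `ℓ²(X, μ)`. -/
def Q0 : HermForm (L2 μ) := (Qc G μ V).closure

/-- `H⁰`, the operator associated with `Q⁰`. -/
def H0 : L2 μ →ₗ.[ℂ] L2 μ := (Q0 G μ V).operator

/-- A self-adjoint operator `T` on `ℓ²(X, μ)` is a realization of `𝓗` if it is bounded from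
below, the domain of its quadratic form (the closed form with which `T` is associated) contains
`C_c(X)`, and `T` is a restriction of `𝓗`. -/
structure IsRealization (T : L2 μ →ₗ.[ℂ] L2 μ) : Prop where
  selfAdjoint : IsSelfAdjoint T
  semibounded : ∃ C : ℝ, ∀ f : T.domain, C * ‖(f : L2 μ)‖ ^ 2 ≤ (inner ℂ (f : L2 μ) (T f)).re
  form_domain : ∃ q : HermForm (L2 μ), q.IsClosedForm ∧ q.operator = T ∧ finSupp μ ≤ q.domain
  restriction : ∀ f : T.domain, ((f : L2 μ) : X → ℂ) ∈ formalDomain G ∧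
    ∀ x, (T f) x = formalOperator G μ V (f : L2 μ) x

/-- The first Beurling-Deny criterion for a closed lower semi-bounded form. -/
def FirstBeurlingDeny {μ : Weight X} (q : HermForm (L2 μ)) : Prop :=
  ∀ f : q.domain, ∃ h : (f : L2 μ).abs ∈ q.domain, q.quad ⟨(f : L2 μ).abs, h⟩ ≤ q.quad f

end Schrodinger

end DiscreteSchrodinger

end

/-! Everything rests on testing the form against the indicator $\delta_x$. Green's formula
(`energy_delta`) gives $\mathcal Q^c(\delta_x,u)=\mu(x)\mathcal H u(x)$, a multiple of $u(x)$ minus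
the edge sum $\sum_y b(x,y)u(y)$. Passing from $u$ to $|u|$ does not increase the form norm
(`quad_abs_le`), so testing $|u|$ bounds $\sum_y b(x,y)|u(y)|$ by a constant times the form norm of
$u$ (`exists_edge_sum_le`). Hence a form-Cauchy sequence $u_n\to f$ in $\ell^2$ also converges in
each $\ell^1(b(x,\cdot))$, so $f\in\mathcal F$ and $\mathcal Q^c(\delta_x,u_n)\to\mu(x)\mathcal
Hf(x)$ (`tendsto_Qc_form_delta`).

For $f=0$ this shows that $u_n$ tends weakly to zero in the form space, as the $\delta_x$ span
$C_c(X)$. The abstract completion therefore embeds injectively into $\ell^2$ and is the closure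
(`exists_isClosureOf`). For $f\in D(H^0)$ it identifies $\langle\delta_x,H^0f\rangle$ with
$\mu(x)\mathcal Hf(x)$.

With $\iota$ the inclusion of the form space, $\iota\iota^*$ is a bounded injective self-adjoint
operator and is the inverse of $H^0+(1-C)$, so $H^0$ is self-adjoint. The Beurling–Deny criterion
passes from $C_c(X)$ to the closure by lower semicontinuity of closed forms (`quad_le_of_tendsto`).
-/

noncomputable section

namespace DiscreteSchrodinger

/-! ### Resolvents and weak compactness in Hilbert spaces -/

section Abstract

variable {H K : Type*} [NormedAddCommGroup H] [InnerProductSpace ℂ H]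
  [NormedAddCommGroup K] [InnerProductSpace ℂ K]

/-- The operator `A⁻¹ - c` is self-adjoint for a bounded injective self-adjoint operator `A`. -/
theorem isSelfAdjoint_toLinearPMap_of_resolvent [CompleteSpace H] {A : H →L[ℂ] H}
    (hA : ∀ x y, inner ℂ (A x) y = inner ℂ x (A y)) (hinj : ∀ x, A x = 0 → x = 0) (c : ℝ)
    {g : Submodule ℂ (H × H)} (hg : ∀ p : H × H, p ∈ g ↔ A (p.2 + (c : ℂ) • p.1) = p.1) :
    IsSelfAdjoint g.toLinearPMap := by
  have hfun : ∀ x ∈ g, x.1 = 0 → x.2 = 0 := by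
    intro x hx hx0
    have h := (hg x).1 hx
    rw [hx0, smul_zero, add_zero] at h
    exact hinj _ h
  have hgraph : g.toLinearPMap.graph = g := g.toLinearPMap_graph_eq hfun
  -- These pairs parametrize the graph, so the domain contains the range of `A`, dense because `A`
  -- is symmetric and injective. They also suffice as test elements for the adjoint.
  have hmem : ∀ w, (A w, w - (c : ℂ) • A w) ∈ g := fun w => by
    rw [hg]; simp
  have hdense : Dense (g.toLinearPMap.domain : Set H) := by
    rw [Submodule.dense_iff_topologicalClosure_eq_top, Submodule.topologicalClosure_eq_top_iff,
      Submodule.eq_bot_iff]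
    intro v hv
    refine hinj v (ext_inner_left ℂ fun w => ?_)
    rw [inner_zero_right, ← hA]
    refine (Submodule.mem_orthogonal _ _).1 hv _ ?_
    rw [Submodule.toLinearPMap_domain]
    exact ⟨_, hmem w, rfl⟩
  rw [LinearPMap.isSelfAdjoint_def]
  refine LinearPMap.eq_of_eq_graph ?_
  rw [LinearPMap.adjoint_graph_eq_graph_adjoint hdense, hgraph]
  ext p
  rw [Submodule.mem_adjoint_iff, hg]
  constructor
  · intro h
    refine ext_inner_left ℂ fun w => ?_
    have h1 := h _ _ (hmem w)
    rw [inner_sub_left, inner_smul_left, hA, hA] at h1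
    rw [map_add, map_smul, inner_add_right, inner_smul_right]
    simp only [Complex.conj_ofReal] at h1
    linear_combination -h1
  · intro h a b hab
    have h1 := (hg (a, b)).1 hab
    simp only at h1
    have h2 : inner ℂ (A (b + (c : ℂ) • a)) (p.2 + (c : ℂ) • p.1)
        = inner ℂ (b + (c : ℂ) • a) p.1 := by rw [hA, h]
    rw [h1] at h2
    simp only [inner_add_left, inner_add_right, inner_smul_left, inner_smul_right,
      Complex.conj_ofReal] at h2
    linear_combination -h2

/-- Norm balls of a Hilbert space are weakly sequentially compact, seen through a bounded operator. -/
theorem exists_preimage_norm_le [CompleteSpace H] [CompleteSpace K] {ι : K →L[ℂ] H}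
    {k : ℕ → K} {a : ℕ → ℝ} {r : ℝ} (hk : ∀ n, ‖k n‖ ≤ a n) (ha : Tendsto a atTop (𝓝 r))
    {g : H} (hg : Tendsto (fun n => ι (k n)) atTop (𝓝 g)) : ∃ l : K, ι l = g ∧ ‖l‖ ≤ r := by
  obtain ⟨M, hM⟩ := ha.bddAbove_range
  have hkM : ∀ n, ‖k n‖ ≤ M := fun n => (hk n).trans (hM ⟨n, rfl⟩)
  -- An ultrafilter finer than `atTop` replaces a weakly convergent subsequence.
  let U : Ultrafilter ℕ := hyperfilter ℕ
  have hU : (U : Filter ℕ) ≤ atTop := Nat.hyperfilter_le_atTop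
  let φ : ℕ → WeakDual ℂ K := fun n =>
    StrongDual.toWeakDual (InnerProductSpace.toDual ℂ K (k n))
  have hball : ∀ n, φ n ∈ WeakDual.toStrongDual ⁻¹' Metric.closedBall (0 : StrongDual ℂ K) M := by
    intro n
    rw [Set.mem_preimage, mem_closedBall_zero_iff]
    change ‖InnerProductSpace.toDual ℂ K (k n)‖ ≤ M
    rw [LinearIsometryEquiv.norm_map]
    exact hkM n
  obtain ⟨ψ, -, hψ⟩ := (WeakDual.isCompact_closedBall (0 : StrongDual ℂ K) M).ultrafilter_le_nhds
    (U.map φ) (by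
      rw [le_principal_iff]
      exact Filter.mem_map.2 (Filter.univ_mem' hball))
  have hψ' : Tendsto φ U (𝓝 ψ) := hψ
  obtain ⟨l, hl⟩ := (InnerProductSpace.toDual ℂ K).surjective (WeakDual.toStrongDual ψ)
  have hlim : ∀ h : K, Tendsto (fun n => inner ℂ (k n) h) U (𝓝 (inner ℂ l h)) := by
    intro h
    have h1 := ((WeakDual.eval_continuous h).tendsto ψ).comp hψ'
    have h2 : ψ h = inner ℂ l h := by
      change WeakDual.toStrongDual ψ h = _
      rw [← hl, InnerProductSpace.toDual_apply_apply]
    rw [h2] at h1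
    exact h1
  refine ⟨l, ?_, ?_⟩
  · refine ext_inner_right ℂ fun w => ?_
    rw [← ContinuousLinearMap.adjoint_inner_right]
    refine tendsto_nhds_unique (hlim _) ?_
    simp only [ContinuousLinearMap.adjoint_inner_right]
    exact (hg.mono_left hU).inner tendsto_const_nhds
  -- Evaluating the weak limit at `l` itself gives `‖l‖² ≤ r ‖l‖`.
  · have h1 : Tendsto (fun n => ‖inner ℂ (k n) l‖) U (𝓝 (‖l‖ * ‖l‖)) := by
      have := (hlim l).norm
      rwa [inner_self_eq_norm_sq_to_K, norm_pow, RCLike.norm_ofReal, abs_norm, sq] at this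
    have h2 : ‖l‖ * ‖l‖ ≤ r * ‖l‖ :=
      le_of_tendsto_of_tendsto' h1 ((ha.mono_left hU).mul_const _) fun n =>
        (norm_inner_le_norm _ _).trans (mul_le_mul_of_nonneg_right (hk n) (norm_nonneg _))
    rcases (norm_nonneg l).eq_or_lt with h0 | h0
    · rw [← h0]
      exact ge_of_tendsto' ha fun n => (norm_nonneg _).trans (hk n)
    · exact le_of_mul_le_mul_right h2 h0

end Abstract

/-! ### The form space of a semibounded form and the associated operator -/

namespace HermForm

variable {H : Type*} [NormedAddCommGroup H] [InnerProductSpace ℂ H]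

/-- The domain of a form with lower bound `C`, with the inner product `q(f, g) + (1 - C) ⟨f, g⟩`. -/
def FormSpace (q : HermForm H) {C : ℝ} (_ : q.IsLowerBound C) : Type _ := q.domain

namespace FormSpace

variable {q : HermForm H} {C : ℝ} {hC : q.IsLowerBound C}

instance : AddCommGroup (FormSpace q hC) := inferInstanceAs (AddCommGroup q.domain)
instance : Module ℂ (FormSpace q hC) := inferInstanceAs (Module ℂ q.domain)

theorem form_self (q : HermForm H) (f : q.domain) : q.form f f = (q.quad f : ℂ) :=
  (Complex.conj_eq_iff_re.1 (q.conj_form f f)).symm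

theorem form_add_inner_self (q : HermForm H) (C : ℝ) (f : q.domain) :
    q.form f f + ((1 - C : ℝ) : ℂ) * inner ℂ (f : H) (f : H)
      = ((q.quad f + (1 - C) * ‖(f : H)‖ ^ 2 : ℝ) : ℂ) := by
  rw [form_self, inner_self_eq_norm_sq_to_K]
  push_cast
  rfl

/-- The inner product `q(f, g) + (1 - C) ⟨f, g⟩` on the domain of `q`. -/
def domainCore (hC : q.IsLowerBound C) : InnerProductSpace.Core ℂ q.domain where
  inner f g := q.form f g + ((1 - C : ℝ) : ℂ) * inner ℂ (f : H) (g : H)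
  conj_inner_symm f g := by
    simp only [map_add, map_mul, q.conj_form, Complex.conj_ofReal, inner_conj_symm]
  re_inner_nonneg f := by
    rw [form_add_inner_self]
    change 0 ≤ q.quad f + (1 - C) * ‖(f : H)‖ ^ 2
    nlinarith [sq_nonneg ‖(f : H)‖, hC f]
  add_left f g h := by
    simp only [map_add, LinearMap.add_apply, Submodule.coe_add, inner_add_left]
    ring
  smul_left f g c := by
    simp only [LinearMap.map_smulₛₗ, LinearMap.smul_apply, Submodule.coe_smul, inner_smul_left,
      smul_eq_mul]
    ring
  definite f hf := by
    rw [form_add_inner_self, Complex.ofReal_eq_zero] at hf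
    have h2 : ‖(f : H)‖ ^ 2 = 0 := by
      nlinarith [sq_nonneg ‖(f : H)‖, hC f]
    exact Subtype.ext (norm_eq_zero.1 (pow_eq_zero_iff two_ne_zero |>.1 h2))

instance core : InnerProductSpace.Core ℂ (FormSpace q hC) := domainCore hC

instance : NormedAddCommGroup (FormSpace q hC) := core.toNormedAddCommGroup
instance : InnerProductSpace ℂ (FormSpace q hC) := InnerProductSpace.ofCore core.toCore

/-- An element of the domain, in the form space. -/
def of (hC : q.IsLowerBound C) : q.domain ≃ₗ[ℂ] FormSpace q hC := LinearEquiv.refl ℂ q.domain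

theorem inner_of (f g : q.domain) : inner ℂ (of hC f) (of hC g)
    = q.form f g + ((1 - C : ℝ) : ℂ) * inner ℂ (f : H) (g : H) := rfl

theorem norm_sq_of (f : q.domain) :
    ‖of hC f‖ ^ 2 = q.quad f + (1 - C) * ‖(f : H)‖ ^ 2 := by
  rw [← inner_self_eq_norm_sq (𝕜 := ℂ), inner_of, form_add_inner_self]
  rfl

/-- The shift is `1 - C` and not `-C` so that a full `‖f‖²` remains beyond the lower bound; this
makes the inclusion a contraction. -/
theorem norm_le_norm_of (f : q.domain) : ‖(f : H)‖ ≤ ‖of hC f‖ := by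
  refine (sq_le_sq₀ (norm_nonneg _) (norm_nonneg _)).1 ?_
  rw [norm_sq_of]
  linarith [hC f]

/-- The inclusion of the form space in the ambient space. -/
def incl (hC : q.IsLowerBound C) : FormSpace q hC →L[ℂ] H :=
  LinearMap.mkContinuous (q.domain.subtype ∘ₗ (of hC).symm.toLinearMap) 1 fun f => by
    rw [one_mul]
    exact norm_le_norm_of (hC := hC) ((of hC).symm f)

@[simp] theorem incl_of (f : q.domain) : incl hC (of hC f) = (f : H) := rfl

theorem incl_injective : Function.Injective (incl hC) := Subtype.val_injective

end FormSpace

open FormSpace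

variable {q : HermForm H} {C : ℝ}

/-- Any Rayleigh quotient is an upper bound. On the zero domain every real is a lower bound and
`lambda0` is the default value 0, hence the `Nontrivial` assumptions below. -/
theorem bddAbove_isLowerBound {f : q.domain} (hf : f ≠ 0) :
    BddAbove {C : ℝ | q.IsLowerBound C} := by
  have h0 : 0 < ‖(f : H)‖ ^ 2 := pow_pos (norm_pos_iff.2 (Subtype.coe_ne_coe.2 hf)) 2
  refine ⟨q.quad f / ‖(f : H)‖ ^ 2, fun C hC => ?_⟩
  rw [le_div_iff₀ h0]
  exact hC f

theorem isLowerBound_lambda0 [Nontrivial q.domain] (hC : q.IsLowerBound C) :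
    q.IsLowerBound q.lambda0 := by
  intro f
  by_cases hf : f = 0
  · simp [hf, quad]
  · have h0 : 0 < ‖(f : H)‖ ^ 2 := pow_pos (norm_pos_iff.2 (Subtype.coe_ne_coe.2 hf)) 2
    rw [← le_div_iff₀ h0]
    exact csSup_le ⟨C, hC⟩ fun D hD => (le_div_iff₀ h0).2 (hD f)

theorem le_lambda0 [Nontrivial q.domain] (hC : q.IsLowerBound C) : C ≤ q.lambda0 := by
  obtain ⟨f, hf⟩ := exists_ne (0 : q.domain)
  exact le_csSup (bddAbove_isLowerBound hf) hC

theorem formNormSq_le [Nontrivial q.domain] (hC : q.IsLowerBound C) (f : q.domain) :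
    q.formNormSq f ≤ ‖of hC f‖ ^ 2 := by
  rw [norm_sq_of, formNormSq]
  nlinarith [le_lambda0 hC, sq_nonneg ‖(f : H)‖]

theorem formNormSq_nonneg [Nontrivial q.domain] (hC : q.IsLowerBound C) (f : q.domain) :
    0 ≤ q.formNormSq f := by
  rw [formNormSq]
  nlinarith [isLowerBound_lambda0 hC f, sq_nonneg ‖(f : H)‖]

/-- The two squared norms differ by `(λ₀ - C) ‖f‖²`, and `‖f‖²` is at most `formNormSq f`. Any lower
bound thus yields an equivalent norm. -/
theorem norm_sq_of_le [Nontrivial q.domain] (hC : q.IsLowerBound C) (f : q.domain) :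
    ‖of hC f‖ ^ 2 ≤ (q.lambda0 - C + 1) * q.formNormSq f := by
  have h1 := isLowerBound_lambda0 hC f
  have h2 := le_lambda0 hC
  have h3 : ‖(f : H)‖ ^ 2 ≤ q.formNormSq f := by
    rw [formNormSq]
    linarith
  have h4 : ‖of hC f‖ ^ 2 = q.formNormSq f + (q.lambda0 - C) * ‖(f : H)‖ ^ 2 := by
    rw [norm_sq_of, formNormSq]
    ring
  nlinarith

theorem tendsto_formNormSq_iff [Nontrivial q.domain] (hC : q.IsLowerBound C) {u : ℕ → q.domain}
    {f : q.domain} : Tendsto (fun n => q.formNormSq (u n - f)) atTop (𝓝 0) ↔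
      Tendsto (fun n => of hC (u n)) atTop (𝓝 (of hC f)) := by
  have key : Tendsto (fun n => of hC (u n)) atTop (𝓝 (of hC f)) ↔
      Tendsto (fun n => ‖of hC (u n - f)‖ ^ 2) atTop (𝓝 0) := by
    rw [tendsto_iff_norm_sub_tendsto_zero]
    simp only [← map_sub]
    refine ⟨fun h => by simpa using h.pow 2, fun h => ?_⟩
    simpa [Real.sqrt_sq] using h.sqrt
  rw [key]
  constructor
  · intro h
    refine squeeze_zero (fun n => sq_nonneg _) (fun n => norm_sq_of_le hC _) ?_
    simpa using h.const_mul (q.lambda0 - C + 1)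
  · exact squeeze_zero (fun n => formNormSq_nonneg hC _) (fun n => formNormSq_le hC _)

theorem cauchy_formNormSq_iff [Nontrivial q.domain] (hC : q.IsLowerBound C) {u : ℕ → q.domain} :
    (∀ ε > 0, ∃ N, ∀ m ≥ N, ∀ n ≥ N, q.formNormSq (u m - u n) < ε) ↔
      CauchySeq (fun n => of hC (u n)) := by
  rw [Metric.cauchySeq_iff]
  have hpos : 0 < q.lambda0 - C + 1 := by linarith [le_lambda0 hC]
  constructor
  · intro h ε hε
    obtain ⟨N, hN⟩ := h (ε ^ 2 / (q.lambda0 - C + 1)) (by positivity)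
    refine ⟨N, fun m hm n hn => ?_⟩
    rw [dist_eq_norm, ← map_sub]
    refine lt_of_pow_lt_pow_left₀ 2 hε.le ?_
    have := hN m hm n hn
    rw [lt_div_iff₀ hpos] at this
    linarith [norm_sq_of_le hC (u m - u n)]
  · intro h ε hε
    obtain ⟨N, hN⟩ := h (Real.sqrt ε) (Real.sqrt_pos.2 hε)
    refine ⟨N, fun m hm n hn => (formNormSq_le hC _).trans_lt ?_⟩
    have := hN m hm n hn
    rw [dist_eq_norm, ← map_sub] at this
    exact (Real.lt_sqrt (norm_nonneg _)).1 this

theorem isClosedForm_iff_complete [Nontrivial q.domain] (hd : Dense (q.domain : Set H))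
    (hC : q.IsLowerBound C) : q.IsClosedForm ↔ CompleteSpace (FormSpace q hC) := by
  constructor
  · intro h
    refine Metric.complete_of_cauchySeq_tendsto fun u hu => ?_
    obtain ⟨f, hf⟩ := h.complete (fun n => (of hC).symm (u n))
      ((cauchy_formNormSq_iff hC).2 (by simpa using hu))
    exact ⟨of hC f, by simpa using (tendsto_formNormSq_iff hC).1 hf⟩
  · intro h
    refine ⟨hd, ⟨C, hC⟩, fun u hu => ?_⟩
    obtain ⟨f, hf⟩ := cauchySeq_tendsto_of_complete ((cauchy_formNormSq_iff hC).1 hu)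
    exact ⟨(of hC).symm f, (tendsto_formNormSq_iff hC).2 (by simpa using hf)⟩

/-- Adding `(1 - C) ⟨f, h⟩` to both sides of `q(f, h) = ⟨g, h⟩` turns it into the defining identity
of the adjoint of the inclusion at `g + (1 - C) f`. -/
theorem mem_operatorGraph_iff (hC : q.IsLowerBound C) [CompleteSpace H]
    [CompleteSpace (FormSpace q hC)] (p : H × H) :
    p ∈ q.operatorGraph ↔
      (incl hC ∘L (incl hC).adjoint) (p.2 + ((1 - C : ℝ) : ℂ) • p.1) = p.1 := by
  rw [ContinuousLinearMap.comp_apply]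
  constructor
  · rintro ⟨hf, h⟩
    have : (incl hC).adjoint (p.2 + ((1 - C : ℝ) : ℂ) • p.1) = of hC ⟨p.1, hf⟩ := by
      refine ext_inner_right ℂ fun v => ?_
      obtain ⟨v, rfl⟩ := (of hC).surjective v
      rw [ContinuousLinearMap.adjoint_inner_left, inner_of, h v, incl_of, inner_add_left,
        inner_smul_left, Complex.conj_ofReal]
    rw [this, incl_of]
  · intro h
    obtain ⟨f, hf⟩ := (of hC).surjective ((incl hC).adjoint (p.2 + ((1 - C : ℝ) : ℂ) • p.1))
    rw [← hf, incl_of] at h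
    refine ⟨h ▸ f.2, fun v => ?_⟩
    have h1 := ContinuousLinearMap.adjoint_inner_left (incl hC) (of hC v)
      (p.2 + ((1 - C : ℝ) : ℂ) • p.1)
    rw [← hf, inner_of, incl_of, inner_add_left, inner_smul_left, Complex.conj_ofReal, h] at h1
    have e : (⟨p.1, h ▸ f.2⟩ : q.domain) = f := Subtype.ext h.symm
    rw [e]
    exact add_right_cancel h1

/-- The kernel of the adjoint is the orthogonal complement of the dense domain. -/
theorem adjoint_incl_injective (hC : q.IsLowerBound C) [CompleteSpace H]
    [CompleteSpace (FormSpace q hC)] (hd : Dense (q.domain : Set H)) {x : H}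
    (hx : (incl hC ∘L (incl hC).adjoint) x = 0) : x = 0 := by
  have h1 : (incl hC).adjoint x = 0 := incl_injective (by simpa using hx)
  refine hd.eq_zero_of_inner_left ℂ fun v hv => ?_
  have h2 := ContinuousLinearMap.adjoint_inner_left (incl hC) (of hC ⟨v, hv⟩) x
  rw [h1, inner_zero_left, incl_of] at h2
  exact h2.symm

/-- The operator associated with a closed form is self-adjoint. -/
theorem isSelfAdjoint_operator [CompleteSpace H] [Nontrivial q.domain] (hq : q.IsClosedForm) :
    IsSelfAdjoint q.operator := by
  obtain ⟨C, hC⟩ := hq.lowerSemibounded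
  have := (isClosedForm_iff_complete hq.dense hC).1 hq
  refine isSelfAdjoint_toLinearPMap_of_resolvent (A := incl hC ∘L (incl hC).adjoint)
    (fun x y => ?_) (fun x => adjoint_incl_injective hC hq.dense) (1 - C)
    (mem_operatorGraph_iff hC)
  simp [← ContinuousLinearMap.adjoint_inner_right]

/-- Injectivity of the resolvent makes the graph relation single-valued, so the partial map really
takes its values in it. -/
theorem mem_operatorGraph [CompleteSpace H] [Nontrivial q.domain] (hq : q.IsClosedForm)
    (f : q.operator.domain) : ((f : H), q.operator f) ∈ q.operatorGraph := by
  obtain ⟨C, hC⟩ := hq.lowerSemibounded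
  have := (isClosedForm_iff_complete hq.dense hC).1 hq
  refine Submodule.mem_graph_toLinearPMap (fun x hx hx0 => ?_) f
  have h := (mem_operatorGraph_iff hC x).1 hx
  rw [hx0, smul_zero, add_zero] at h
  exact adjoint_incl_injective hC hq.dense h

theorem operator_semibounded [CompleteSpace H] [Nontrivial q.domain] (hq : q.IsClosedForm) :
    ∃ C : ℝ, ∀ f : q.operator.domain, C * ‖(f : H)‖ ^ 2 ≤ (inner ℂ (f : H) (q.operator f)).re := by
  obtain ⟨C, hC⟩ := hq.lowerSemibounded
  refine ⟨C, fun f => ?_⟩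
  obtain ⟨hf, h⟩ := mem_operatorGraph hq f
  refine (hC ⟨f, hf⟩).trans_eq ?_
  rw [quad, h, ← inner_conj_symm, Complex.conj_re]

/-- Lower semicontinuity of closed forms. -/
theorem quad_le_of_tendsto [CompleteSpace H] [Nontrivial q.domain] (hq : q.IsClosedForm)
    {u : ℕ → q.domain} {g : H} (hu : Tendsto (fun n => (u n : H)) atTop (𝓝 g)) {a : ℕ → ℝ} {r : ℝ}
    (ha : Tendsto a atTop (𝓝 r)) (hua : ∀ n, q.quad (u n) ≤ a n) :
    ∃ h : g ∈ q.domain, q.quad ⟨g, h⟩ ≤ r := by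
  obtain ⟨C, hC⟩ := hq.lowerSemibounded
  have := (isClosedForm_iff_complete hq.dense hC).1 hq
  have hlim : Tendsto (fun n => a n + (1 - C) * ‖(u n : H)‖ ^ 2) atTop
      (𝓝 (r + (1 - C) * ‖g‖ ^ 2)) := ha.add ((hu.norm.pow 2).const_mul _)
  have hle : ∀ n, ‖of hC (u n)‖ ^ 2 ≤ a n + (1 - C) * ‖(u n : H)‖ ^ 2 := fun n => by
    rw [norm_sq_of]
    linarith [hua n]
  -- The form norms are bounded by a convergent sequence, so a weak limit in the form space lies
  -- over `g` and inherits the limiting bound.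
  obtain ⟨l, hl, hlr⟩ := exists_preimage_norm_le (ι := incl hC)
    (fun n => Real.le_sqrt_of_sq_le (hle n)) hlim.sqrt (g := g) (by simpa using hu)
  obtain ⟨f, rfl⟩ := (of hC).surjective l
  rw [incl_of] at hl
  subst hl
  refine ⟨f.2, ?_⟩
  have h0 : 0 ≤ r + (1 - C) * ‖(f : H)‖ ^ 2 :=
    ge_of_tendsto' hlim fun n => (sq_nonneg _).trans (hle n)
  have := (Real.le_sqrt (norm_nonneg _) h0).1 hlr
  rw [norm_sq_of] at this
  simpa using this

end HermForm

/-! ### The closure as a completion embedded in the Hilbert space -/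

namespace HermForm

open FormSpace

variable {H K : Type*} [NormedAddCommGroup H] [InnerProductSpace ℂ H]
  [NormedAddCommGroup K] [InnerProductSpace ℂ K]

/-- The form with lower bound `C` on the range of an injective contraction `ι : K → H` whose form
space is `K`. -/
def ofEmbedding (ι : K →L[ℂ] H) (hι : Function.Injective ι) (C : ℝ) : HermForm H where
  domain := ι.range
  form :=
    let e := LinearEquiv.ofInjective ι.toLinearMap hι
    LinearMap.mk₂'ₛₗ (starRingEnd ℂ) (RingHom.id ℂ)
      (fun f g => inner ℂ (e.symm f) (e.symm g) - ((1 - C : ℝ) : ℂ) * inner ℂ (f : H) (g : H))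
      (fun f f' g => by
        simp only [map_add, Submodule.coe_add, inner_add_left]
        ring)
      (fun c f g => by
        simp only [map_smul, Submodule.coe_smul, inner_smul_left, smul_eq_mul]
        ring)
      (fun f g g' => by
        simp only [map_add, Submodule.coe_add, inner_add_right]
        ring)
      (fun c f g => by
        simp only [map_smul, Submodule.coe_smul, inner_smul_right, smul_eq_mul, RingHom.id_apply]
        ring)
  conj_form f g := by
    simp only [LinearMap.mk₂'ₛₗ_apply, map_sub, map_mul, inner_conj_symm, Complex.conj_ofReal]

section

variable {ι : K →L[ℂ] H} (hι : Function.Injective ι) {C : ℝ}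

theorem ofEmbedding_form (k l : K) :
    (ofEmbedding ι hι C).form ⟨ι k, k, rfl⟩ ⟨ι l, l, rfl⟩
      = inner ℂ k l - ((1 - C : ℝ) : ℂ) * inner ℂ (ι k) (ι l) := by
  have h : ∀ k, (LinearEquiv.ofInjective ι.toLinearMap hι).symm ⟨ι k, k, rfl⟩ = k := fun k =>
    (LinearEquiv.symm_apply_eq _).2 rfl
  change inner ℂ ((LinearEquiv.ofInjective ι.toLinearMap hι).symm ⟨ι k, k, rfl⟩)
    ((LinearEquiv.ofInjective ι.toLinearMap hι).symm ⟨ι l, l, rfl⟩) - _ = _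
  rw [h, h]

theorem ofEmbedding_quad (k : K) :
    (ofEmbedding ι hι C).quad ⟨ι k, k, rfl⟩ = ‖k‖ ^ 2 - (1 - C) * ‖ι k‖ ^ 2 := by
  have h : inner ℂ k k - ((1 - C : ℝ) : ℂ) * inner ℂ (ι k) (ι k)
      = ((‖k‖ ^ 2 - (1 - C) * ‖ι k‖ ^ 2 : ℝ) : ℂ) := by
    rw [inner_self_eq_norm_sq_to_K, inner_self_eq_norm_sq_to_K]
    push_cast
    rfl
  rw [quad, ofEmbedding_form, h, Complex.ofReal_re]

theorem isLowerBound_ofEmbedding (h1 : ∀ k, ‖ι k‖ ≤ ‖k‖) :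
    (ofEmbedding ι hι C).IsLowerBound C := by
  rintro ⟨_, k, rfl⟩
  refine le_of_le_of_eq ?_ (ofEmbedding_quad hι k).symm
  change C * ‖ι k‖ ^ 2 ≤ _
  have := pow_le_pow_left₀ (norm_nonneg _) (h1 k) 2
  linarith

/-- The form space of `ofEmbedding ι hι C` is isometric to `K`. -/
def ofEmbeddingEquiv (h1 : ∀ k, ‖ι k‖ ≤ ‖k‖) :
    K ≃ₗᵢ[ℂ] FormSpace (ofEmbedding ι hι C) (isLowerBound_ofEmbedding hι h1) where
  toLinearEquiv := (LinearEquiv.ofInjective ι.toLinearMap hι).trans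
    (of (isLowerBound_ofEmbedding hι h1))
  norm_map' k := by
    refine (sq_eq_sq₀ (norm_nonneg _) (norm_nonneg _)).1 ?_
    change ‖of (isLowerBound_ofEmbedding hι h1) ⟨ι k, k, rfl⟩‖ ^ 2 = _
    rw [norm_sq_of, ofEmbedding_quad]
    ring

end

/-- A densely defined lower semi-bounded form has a closure, provided that every sequence which is
Cauchy for the form norm and converges to zero in `H` converges weakly to zero for the form
norm. -/
theorem exists_isClosureOf [CompleteSpace H] {q : HermForm H} [Nontrivial q.domain]
    (hd : Dense (q.domain : Set H)) {C : ℝ} (hC : q.IsLowerBound C)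
    (hq : ∀ u : ℕ → q.domain, CauchySeq (fun n => of hC (u n)) →
      Tendsto (fun n => (u n : H)) atTop (𝓝 0) → ∀ f : q.domain,
        Tendsto (fun n => inner ℂ (of hC f) (of hC (u n))) atTop (𝓝 0)) :
    ∃ q' : HermForm H, q'.IsClosureOf q := by
  let j : FormSpace q hC →L[ℂ] UniformSpace.Completion (FormSpace q hC) :=
    UniformSpace.Completion.toComplL
  have hj : DenseRange j := UniformSpace.Completion.denseRange_coe
  have hjn : ∀ f, ‖j f‖ = ‖f‖ := UniformSpace.Completion.norm_coe
  have hji : ∀ f g, inner ℂ (j f) (j g) = inner ℂ f g := UniformSpace.Completion.inner_coe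
  let ι : UniformSpace.Completion (FormSpace q hC) →L[ℂ] H := (incl hC).extend j
  have hιj : ∀ f, ι (j f) = incl hC f := fun f =>
    ContinuousLinearMap.extend_eq _ hj (UniformSpace.Completion.isUniformInducing_coe _) f
  have h1 : ∀ k, ‖ι k‖ ≤ ‖k‖ := by
    intro k
    induction k using hj.induction_on with
    | hp => exact isClosed_le ι.continuous.norm continuous_norm
    | ih f =>
      rw [hιj, hjn]
      exact norm_le_norm_of (hC := hC) ((of hC).symm f)
  have hseq : ∀ k, ∃ u : ℕ → q.domain, Tendsto (fun n => j (of hC (u n))) atTop (𝓝 k) := by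
    intro k
    obtain ⟨v, hv, hk⟩ := mem_closure_iff_seq_limit.1 (hj k)
    choose w hw using hv
    refine ⟨fun n => (of hC).symm (w n), ?_⟩
    simpa [hw] using hk
  -- This is closability: an element of the kernel is a limit of a form-Cauchy sequence that
  -- vanishes in `H`, so by `hq` it is orthogonal to a dense set.
  have hι : Function.Injective ι := by
    refine (injective_iff_map_eq_zero ι).2 fun k hk => ?_
    obtain ⟨u, hu⟩ := hseq k
    have hc : CauchySeq (fun n => of hC (u n)) := by
      have := hu.cauchySeq
      rw [Metric.cauchySeq_iff] at this ⊢
      simpa only [dist_eq_norm, ← map_sub, hjn] using this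
    have h0 : Tendsto (fun n => (u n : H)) atTop (𝓝 0) := by
      have := (ι.continuous.tendsto k).comp hu
      rw [hk] at this
      simpa only [Function.comp_def, hιj, incl_of] using this
    have hw : ∀ l, inner ℂ l k = 0 := by
      intro l
      induction l using hj.induction_on with
      | hp => exact isClosed_eq (continuous_id.inner continuous_const) continuous_const
      | ih f =>
        obtain ⟨f, rfl⟩ := (of hC).surjective f
        refine tendsto_nhds_unique (tendsto_const_nhds.inner hu) ?_
        simpa only [hji] using hq u hc h0 f
    exact inner_self_eq_zero.1 (hw k)
  have hle : q.domain ≤ (ofEmbedding ι hι C).domain := fun f hf => ⟨j (of hC ⟨f, hf⟩), hιj _⟩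
  have : Nontrivial (ofEmbedding ι hι C).domain :=
    (Submodule.inclusion_injective hle).nontrivial
  refine ⟨ofEmbedding ι hι C, ?_, ⟨hle, fun f g => ?_⟩, ?_⟩
  · refine (isClosedForm_iff_complete (hd.mono hle) (isLowerBound_ofEmbedding hι h1)).2 ?_
    exact (ofEmbeddingEquiv hι h1).toIsometryEquiv.symm.completeSpace
  · have e : ∀ f, Submodule.inclusion hle f = ⟨ι (j (of hC f)), _, rfl⟩ := fun f =>
      Subtype.ext (hιj (of hC f)).symm
    rw [e, e, ofEmbedding_form, hji, inner_of, hιj, hιj]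
    exact add_sub_cancel_right _ _
  · rintro ⟨_, k, rfl⟩
    obtain ⟨u, hu⟩ := hseq k
    refine ⟨fun n => ⟨ι (j (of hC (u n))), _, rfl⟩, fun n => ?_, ?_⟩
    · change ι (j (of hC (u n))) ∈ _
      rw [hιj]
      exact (u n).2
    · rw [tendsto_formNormSq_iff (isLowerBound_ofEmbedding hι h1)]
      exact ((ofEmbeddingEquiv hι h1 (C := C)).continuous.tendsto k).comp hu

end HermForm

/-! ### Point evaluations and absolute values on the weighted space -/

variable {X : Type*} {μ : Weight X}

namespace L2

theorem abs_apply (f : L2 μ) (x : X) : f.abs x = (‖f x‖ : ℂ) := rfl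

@[simp] theorem norm_abs_apply (f : L2 μ) (x : X) : ‖f.abs x‖ = ‖f x‖ := by
  rw [abs_apply, Complex.norm_real, norm_norm]

theorem norm_abs (f : L2 μ) : ‖f.abs‖ = ‖f‖ := by
  refine (sq_eq_sq₀ (norm_nonneg _) (norm_nonneg _)).1 ?_
  simp only [norm_sq_eq, norm_abs_apply]

theorem norm_apply_mul_sqrt_le (f : L2 μ) (x : X) : ‖f x‖ * Real.sqrt (μ x) ≤ ‖f‖ := by
  refine (sq_le_sq₀ (by positivity) (norm_nonneg _)).1 ?_
  rw [mul_pow, Real.sq_sqrt (μ.pos x).le, norm_sq_eq]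
  exact f.summable_sq.le_tsum x fun y _ => mul_nonneg (sq_nonneg _) (μ.pos y).le

theorem norm_apply_le (f : L2 μ) (x : X) : ‖f x‖ ≤ ‖f‖ / Real.sqrt (μ x) :=
  (le_div_iff₀ (Real.sqrt_pos.2 (μ.pos x))).2 (norm_apply_mul_sqrt_le f x)

theorem tendsto_apply {u : ℕ → L2 μ} {f : L2 μ} (h : Tendsto u atTop (𝓝 f)) (x : X) :
    Tendsto (fun n => u n x) atTop (𝓝 (f x)) := by
  rw [tendsto_iff_norm_sub_tendsto_zero] at h ⊢
  refine squeeze_zero (fun n => norm_nonneg _) (fun n => norm_apply_le (u n - f) x) ?_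
  simpa using h.div_const (Real.sqrt (μ x))

theorem norm_abs_sub_abs_le (f g : L2 μ) : ‖f.abs - g.abs‖ ≤ ‖f - g‖ := by
  refine (sq_le_sq₀ (norm_nonneg _) (norm_nonneg _)).1 ?_
  rw [norm_sq_eq, norm_sq_eq]
  refine (f.abs - g.abs).summable_sq.tsum_le_tsum (fun x => ?_) (f - g).summable_sq
  refine mul_le_mul_of_nonneg_right (pow_le_pow_left₀ (norm_nonneg _) ?_ 2) (μ.pos x).le
  rw [sub_apply, sub_apply, abs_apply, abs_apply, ← Complex.ofReal_sub, Complex.norm_real]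
  exact abs_norm_sub_norm_le _ _

theorem tendsto_abs {u : ℕ → L2 μ} {f : L2 μ} (h : Tendsto u atTop (𝓝 f)) :
    Tendsto (fun n => (u n).abs) atTop (𝓝 f.abs) := by
  rw [tendsto_iff_norm_sub_tendsto_zero] at h ⊢
  exact squeeze_zero (fun n => norm_nonneg _) (fun n => norm_abs_sub_abs_le _ _) h

end L2

/-! ### Finitely supported functions -/

theorem support_finite (u : finSupp μ) : (u : L2 μ).1.support.Finite := u.2

open Classical in
/-- The indicator function of `{x}`, as an element of `C_c(X)`. -/
def delta (μ : Weight X) (x : X) : finSupp μ :=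
  have h : (Pi.single x 1 : X → ℂ).support.Finite :=
    (Set.finite_singleton x).subset Pi.support_single_subset
  ⟨L2.mk (Pi.single x 1) (summable_of_hasFiniteSupport (h.subset fun y hy hy0 => hy (by
    simp [hy0]))), h⟩

theorem delta_self (x : X) : (delta μ x : L2 μ) x = 1 := by
  classical exact Pi.single_eq_same (M := fun _ => ℂ) x 1

theorem delta_of_ne {x y : X} (h : y ≠ x) : (delta μ x : L2 μ) y = 0 := by
  classical exact Pi.single_eq_of_ne (M := fun _ => ℂ) h 1

theorem inner_delta (x : X) (f : L2 μ) : inner ℂ (delta μ x : L2 μ) f = f x * μ x := by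
  rw [L2.inner_def, tsum_eq_single x fun y hy => by rw [delta_of_ne hy]; simp]
  rw [delta_self, map_one, one_mul]

theorem delta_ne_zero (x : X) : delta μ x ≠ 0 := fun h => by
  have h1 := delta_self (μ := μ) x
  rw [h] at h1
  exact zero_ne_one h1

theorem dense_finSupp : Dense (finSupp μ : Set (L2 μ)) := by
  rw [Submodule.dense_iff_topologicalClosure_eq_top, Submodule.topologicalClosure_eq_top_iff,
    Submodule.eq_bot_iff]
  intro f hf
  ext x
  have h := (Submodule.mem_orthogonal _ _).1 hf _ (delta μ x).2
  rw [inner_delta] at h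
  exact (mul_eq_zero.1 h).resolve_right (by exact_mod_cast (μ.pos x).ne')

/-- Reduces testing against all of $C_c(X)$ to testing against the $\delta_x$. -/
theorem eq_sum_delta (u : finSupp μ) :
    u = ∑ x ∈ (support_finite u).toFinset, (u : L2 μ) x • delta μ x := by
  have hs : ∀ (s : Finset X) (y : X), ((∑ x ∈ s, (u : L2 μ) x • delta μ x : finSupp μ) : L2 μ) y
      = ∑ x ∈ s, (u : L2 μ) x * (delta μ x : L2 μ) y := by
    classical
    intro s y
    induction s using Finset.induction_on with
    | empty => rfl
    | insert a s ha ih =>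
      rw [Finset.sum_insert ha, Finset.sum_insert ha, ← ih]
      rfl
  refine Subtype.ext (L2.ext fun y => ?_)
  rw [hs]
  by_cases hy : (u : L2 μ) y = 0
  · rw [hy]
    refine (Finset.sum_eq_zero fun x hx => ?_).symm
    rw [delta_of_ne, mul_zero]
    rintro rfl
    exact (Set.Finite.mem_toFinset _).1 hx hy
  · rw [Finset.sum_eq_single y (fun x _ hx => by rw [delta_of_ne hx.symm, mul_zero])
      (fun h => absurd ((Set.Finite.mem_toFinset _).2 hy) h), delta_self, mul_one]

/-! ### The Schrödinger form against indicators and under absolute values -/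

section

variable (G : WeightedGraph X) (V : X → ℝ)

theorem mem_formalDomain_of_finite {f : X → ℂ} (hf : f.support.Finite) : f ∈ formalDomain G :=
  fun x => summable_of_hasFiniteSupport (hf.subset fun y hy hy0 => hy (by simp [hy0]))

/-- Separates the local term, which pointwise convergence controls, from the edge sum, which needs
the form norm. -/
theorem mul_formalOperator {f : X → ℂ} (hf : f ∈ formalDomain G) (x : X) :
    (μ x : ℂ) * formalOperator G μ V f x = (((∑' y, G.b x y) + V x * μ x : ℝ) : ℂ) * f x
      - ∑' y, (G.b x y : ℂ) * f y := by
  have hμ : (μ x : ℂ) ≠ 0 := by exact_mod_cast (μ.pos x).ne'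
  have h1 : Summable fun y => (G.b x y : ℂ) * f x :=
    (Complex.ofRealCLM.summable (G.summable x)).mul_right (f x)
  have h2 : Summable fun y => (G.b x y : ℂ) * f y :=
    Summable.of_norm ((hf x).congr fun y => by
      rw [norm_mul, Complex.norm_real, Real.norm_of_nonneg (G.nonneg _ _)])
  simp only [formalOperator, mul_sub]
  rw [h1.tsum_sub h2, tsum_mul_right]
  push_cast
  field_simp
  ring

theorem energy_delta {u : X → ℂ} (hu : u.support.Finite) (x : X) :
    energy G μ V (delta μ x : L2 μ) u = μ x * formalOperator G μ V u x := by
  set d : X → ℂ := (delta μ x : L2 μ).1 with hd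
  have hμ : (μ x : ℂ) ≠ 0 := by exact_mod_cast (μ.pos x).ne'
  have hdx : d x = 1 := delta_self x
  have hdy : ∀ y, y ≠ x → d y = 0 := fun y hy => delta_of_ne hy
  -- The edge term at `p` is `F p + F p.swap` by symmetry of `b`. Both halves have the same sum,
  -- which cancels the factor 1/2, and `F` lives on the pairs starting at `x`.
  let F : X × X → ℂ := fun p => (G.b p.1 p.2 : ℂ) * (conj (d p.1) * (u p.1 - u p.2))
  have hinj : Function.Injective fun y : X => (x, y) := fun y z h => (Prod.mk.inj h).2
  have hF : Function.support F ⊆ Set.range fun y : X => (x, y) := by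
    rintro ⟨a, y⟩ h
    by_cases ha : a = x
    · exact ⟨y, by rw [ha]⟩
    · refine absurd ?_ h
      simp only [F]
      rw [hdy a ha]
      simp
  have hFy : ∀ y, F (x, y) = (G.b x y : ℂ) * (u x - u y) := fun y => by
    simp only [F]
    rw [hdx, map_one, one_mul]
  have hsum : Summable F := by
    rw [← hinj.summable_iff fun p hp => by_contra fun h => hp (hF h)]
    refine Summable.congr (g := F ∘ fun y => (x, y))
      (f := fun y => (G.b x y : ℂ) * u x - (G.b x y : ℂ) * u y) ?_ fun y => ?_
    · have h : Summable fun y => (G.b x y : ℂ) * u x :=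
        (Complex.ofRealCLM.summable (G.summable x)).mul_right (u x)
      refine h.sub ?_
      exact summable_of_hasFiniteSupport (hu.subset fun y hy hy0 => hy (by simp [hy0]))
    · rw [Function.comp_apply, hFy, mul_sub]
  have hsum' : Summable fun p : X × X => F p.swap := (Equiv.prodComm X X).summable_iff.2 hsum
  have hswap : ∑' p : X × X, F p.swap = ∑' p, F p := (Equiv.prodComm X X).tsum_eq F
  have htsum : ∑' p, F p = ∑' y, (G.b x y : ℂ) * (u x - u y) := by
    rw [← hinj.tsum_eq hF]
    exact tsum_congr hFy
  have h1 : ∑' p : X × X, (G.b p.1 p.2 : ℂ) * (conj (d p.1 - d p.2) * (u p.1 - u p.2))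
      = 2 * ∑' y, (G.b x y : ℂ) * (u x - u y) := by
    rw [two_mul, ← htsum]
    nth_rewrite 2 [← hswap]
    rw [← hsum.tsum_add hsum']
    refine tsum_congr fun p => ?_
    simp only [F, Prod.fst_swap, Prod.snd_swap, G.symm p.2 p.1, map_sub]
    ring
  have h2 : ∑' y, (V y : ℂ) * conj (d y) * u y * (μ y : ℂ) = V x * u x * μ x := by
    rw [tsum_eq_single x fun y hy => by rw [hdy y hy]; simp]
    rw [hdx, map_one, mul_one]
  rw [energy, h1, h2, formalOperator]
  field_simp

theorem energy_self (f : X → ℂ) :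
    energy G μ V f f = ((1 / 2 * (∑' p : X × X, G.b p.1 p.2 * ‖f p.1 - f p.2‖ ^ 2)
      + ∑' x, V x * ‖f x‖ ^ 2 * μ x : ℝ) : ℂ) := by
  rw [energy]
  push_cast
  congr 2
  · refine tsum_congr fun p => ?_
    rw [Complex.conj_mul']
  · funext x
    rw [mul_assoc (V x : ℂ), Complex.conj_mul']

theorem abs_mem_finSupp (u : finSupp μ) : (u : L2 μ).abs ∈ finSupp μ :=
  (support_finite u).subset fun x hx hx0 => hx (by simp [L2.abs_apply, hx0])

/-- The pointwise absolute value on `C_c(X)`. -/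
def absFinSupp (u : finSupp μ) : finSupp μ := ⟨(u : L2 μ).abs, abs_mem_finSupp u⟩

theorem quad_Qc (u : finSupp μ) : (Qc G μ V).quad u
    = 1 / 2 * (∑' p : X × X, G.b p.1 p.2 * ‖(u : L2 μ) p.1 - (u : L2 μ) p.2‖ ^ 2)
      + ∑' x, V x * ‖(u : L2 μ) x‖ ^ 2 * μ x := by
  change (energy G μ V (u : L2 μ) (u : L2 μ)).re = _
  rw [energy_self, Complex.ofReal_re]

theorem summable_edge_sq {f : X → ℂ} (hf : f.support.Finite) :
    Summable fun p : X × X => G.b p.1 p.2 * ‖f p.1 - f p.2‖ ^ 2 := by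
  refine (summable_edge G hf hf).norm.congr fun p => ?_
  rw [norm_mul, Complex.norm_real, Real.norm_of_nonneg (G.nonneg _ _), norm_mul,
    RCLike.norm_conj, sq]

/-- On each edge the reverse triangle inequality applies, and the potential term sees only absolute
values. -/
theorem quad_abs_le (u : finSupp μ) : (Qc G μ V).quad (absFinSupp u) ≤ (Qc G μ V).quad u := by
  rw [quad_Qc, quad_Qc]
  have h : ∀ x, ‖(absFinSupp u : L2 μ) x‖ = ‖(u : L2 μ) x‖ := L2.norm_abs_apply _
  simp only [h]
  refine add_le_add_left (mul_le_mul_of_nonneg_left ?_ (by norm_num)) _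
  refine (summable_edge_sq G (support_finite (absFinSupp u))).tsum_le_tsum (fun p => ?_)
    (summable_edge_sq G (support_finite u))
  refine mul_le_mul_of_nonneg_left (pow_le_pow_left₀ (norm_nonneg _) ?_ 2) (G.nonneg _ _)
  change ‖(u : L2 μ).abs p.1 - (u : L2 μ).abs p.2‖ ≤ _
  rw [L2.abs_apply, L2.abs_apply, ← Complex.ofReal_sub, Complex.norm_real]
  exact abs_norm_sub_norm_le _ _

theorem Qc_form_delta (x : X) (u : finSupp μ) : (Qc G μ V).form (delta μ x) u
    = (((∑' y, G.b x y) + V x * μ x : ℝ) : ℂ) * (u : L2 μ) x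
      - ∑' y, (G.b x y : ℂ) * (u : L2 μ) y := by
  rw [← mul_formalOperator G V (mem_formalDomain_of_finite G (support_finite u))]
  exact energy_delta G V (support_finite u) x

/-! ### Edge sums controlled by the form norm -/

open HermForm HermForm.FormSpace

variable {G V} {C : ℝ} (hC : (Qc G μ V).IsLowerBound C)

/-- A finitely supported function as an element of the form space of `𝓠ᶜ`. -/
def ofFinSupp : finSupp μ ≃ₗ[ℂ] FormSpace (Qc G μ V) hC := of hC

theorem norm_sq_ofFinSupp (f : finSupp μ) :
    ‖ofFinSupp hC f‖ ^ 2 = (Qc G μ V).quad f + (1 - C) * ‖(f : L2 μ)‖ ^ 2 :=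
  norm_sq_of (hC := hC) f

theorem inner_ofFinSupp (f g : finSupp μ) : inner ℂ (ofFinSupp hC f) (ofFinSupp hC g)
    = (Qc G μ V).form f g + ((1 - C : ℝ) : ℂ) * inner ℂ (f : L2 μ) (g : L2 μ) := rfl

theorem norm_ofFinSupp_abs_le (u : finSupp μ) : ‖ofFinSupp hC (absFinSupp u)‖ ≤ ‖ofFinSupp hC u‖ := by
  refine (sq_le_sq₀ (norm_nonneg _) (norm_nonneg _)).1 ?_
  rw [norm_sq_ofFinSupp, norm_sq_ofFinSupp]
  have h : ‖(absFinSupp u : L2 μ)‖ = ‖(u : L2 μ)‖ := L2.norm_abs _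
  rw [h]
  linarith [quad_abs_le G V u]

theorem norm_apply_le_norm_ofFinSupp (u : finSupp μ) (x : X) :
    ‖(u : L2 μ) x‖ ≤ ‖ofFinSupp hC u‖ / Real.sqrt (μ x) :=
  (L2.norm_apply_le _ x).trans
    (div_le_div_of_nonneg_right (norm_le_norm_of (hC := hC) u) (Real.sqrt_nonneg _))

/-- The edge sum at a vertex is controlled by the form norm. -/
theorem exists_edge_sum_le (x : X) : ∃ c : ℝ, 0 ≤ c ∧ ∀ u : finSupp μ,
    ∑' y, G.b x y * ‖(u : L2 μ) y‖ ≤ c * ‖ofFinSupp hC u‖ := by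
  -- The diagonal coefficient of the shifted inner product with $\delta_x$; the term `(1 - C) μ x`
  -- comes from the shift.
  set a : ℝ := (∑' y, G.b x y) + V x * μ x + (1 - C) * μ x
  refine ⟨|a| / Real.sqrt (μ x) + ‖ofFinSupp hC (delta μ x)‖, by positivity, fun u => ?_⟩
  have h1 := Qc_form_delta G V x (absFinSupp u)
  have h2 := inner_ofFinSupp hC (delta μ x) (absFinSupp u)
  have h3 : inner ℂ (delta μ x : L2 μ) (absFinSupp u : L2 μ) = (‖(u : L2 μ) x‖ : ℂ) * μ x :=
    inner_delta x _
  have h4 : ∀ y, (absFinSupp u : L2 μ) y = (‖(u : L2 μ) y‖ : ℂ) := fun y => rfl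
  simp only [h4] at h1
  rw [h1, h3] at h2
  -- Solving the identity for the edge sum of `|u|` leaves one point value and one inner product,
  -- both bounded by the form norm.
  have h5 : ((∑' y, G.b x y * ‖(u : L2 μ) y‖ : ℝ) : ℂ)
      = (a : ℂ) * (‖(u : L2 μ) x‖ : ℂ) - inner ℂ (ofFinSupp hC (delta μ x)) (ofFinSupp hC (absFinSupp u)) := by
    rw [h2]
    simp only [a]
    push_cast
    ring
  calc ∑' y, G.b x y * ‖(u : L2 μ) y‖
      ≤ ‖((∑' y, G.b x y * ‖(u : L2 μ) y‖ : ℝ) : ℂ)‖ := by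
        rw [Complex.norm_real]
        exact Real.le_norm_self _
    _ ≤ |a| * ‖(u : L2 μ) x‖ + ‖ofFinSupp hC (delta μ x)‖ * ‖ofFinSupp hC (absFinSupp u)‖ := by
        rw [h5]
        refine (norm_sub_le _ _).trans (add_le_add (le_of_eq ?_) (norm_inner_le_norm _ _))
        rw [norm_mul, Complex.norm_real, Complex.norm_real, norm_norm, Real.norm_eq_abs]
    _ ≤ |a| * (‖ofFinSupp hC u‖ / Real.sqrt (μ x)) + ‖ofFinSupp hC (delta μ x)‖ * ‖ofFinSupp hC u‖ :=
        add_le_add (mul_le_mul_of_nonneg_left (norm_apply_le_norm_ofFinSupp hC u x) (abs_nonneg _))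
          (mul_le_mul_of_nonneg_left (norm_ofFinSupp_abs_le hC u) (norm_nonneg _))
    _ = _ := by ring

/-- A Fatou argument: the bound for `u n - u m` is restricted to a finite set, where `m → ∞` is
harmless, and the finite set is then arbitrary. -/
theorem edge_sum_sub_le {u : ℕ → finSupp μ} (hu : CauchySeq fun n => ofFinSupp hC (u n)) {f : X → ℂ}
    (hf : ∀ y, Tendsto (fun n => (u n : L2 μ) y) atTop (𝓝 (f y))) (x : X) {ε : ℝ} (hε : 0 < ε) :
    ∃ N, ∀ n ≥ N, Summable (fun y => G.b x y * ‖(u n : L2 μ) y - f y‖) ∧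
      ∑' y, G.b x y * ‖(u n : L2 μ) y - f y‖ ≤ ε := by
  obtain ⟨c, hc0, hc⟩ := exists_edge_sum_le hC x
  -- Dividing by `c + 1` covers the case `c = 0`.
  obtain ⟨N, hN⟩ := Metric.cauchySeq_iff.1 hu (ε / (c + 1)) (by positivity)
  refine ⟨N, fun n hn => ?_⟩
  have hfin : ∀ s : Finset X, ∑ y ∈ s, G.b x y * ‖(u n : L2 μ) y - f y‖ ≤ ε := by
    intro s
    have hlim : Tendsto (fun m => ∑ y ∈ s, G.b x y * ‖(u n : L2 μ) y - (u m : L2 μ) y‖) atTop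
        (𝓝 (∑ y ∈ s, G.b x y * ‖(u n : L2 μ) y - f y‖)) :=
      tendsto_finsetSum _ fun y _ => ((tendsto_const_nhds.sub (hf y)).norm).const_mul _
    refine le_of_tendsto hlim (eventually_atTop.2 ⟨N, fun m hm => ?_⟩)
    have h1 : ∑ y ∈ s, G.b x y * ‖((u n - u m : finSupp μ) : L2 μ) y‖
        ≤ ∑' y, G.b x y * ‖((u n - u m : finSupp μ) : L2 μ) y‖ :=
      (mem_formalDomain_of_finite G (support_finite (u n - u m)) x).sum_le_tsum s
        fun y _ => mul_nonneg (G.nonneg _ _) (norm_nonneg _)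
    have h2 := hN n hn m hm
    rw [dist_eq_norm, ← map_sub, lt_div_iff₀ (by positivity)] at h2
    refine (h1.trans (hc (u n - u m))).trans ?_
    nlinarith [norm_nonneg (ofFinSupp hC (u n - u m))]
  have h0 : ∀ y, 0 ≤ G.b x y * ‖(u n : L2 μ) y - f y‖ := fun y =>
    mul_nonneg (G.nonneg _ _) (norm_nonneg _)
  exact ⟨summable_of_sum_le h0 hfin, Real.tsum_le_of_sum_le h0 hfin⟩

theorem mem_formalDomain_of_tendsto {u : ℕ → finSupp μ} (hu : CauchySeq fun n => ofFinSupp hC (u n))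
    {f : X → ℂ} (hf : ∀ y, Tendsto (fun n => (u n : L2 μ) y) atTop (𝓝 (f y))) :
    f ∈ formalDomain G := by
  intro x
  obtain ⟨N, hN⟩ := edge_sum_sub_le hC hu hf x one_pos
  refine Summable.of_nonneg_of_le (fun y => mul_nonneg (G.nonneg _ _) (norm_nonneg _))
    (fun y => ?_) ((mem_formalDomain_of_finite G (support_finite (u N)) x).add (hN N le_rfl).1)
  rw [← mul_add]
  refine mul_le_mul_of_nonneg_left ?_ (G.nonneg _ _)
  have h := norm_sub_norm_le (f y) ((u N : L2 μ) y)
  rw [norm_sub_rev] at h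
  linarith

theorem tendsto_Qc_form_delta {u : ℕ → finSupp μ} (hu : CauchySeq fun n => ofFinSupp hC (u n))
    {f : X → ℂ} (hf : ∀ y, Tendsto (fun n => (u n : L2 μ) y) atTop (𝓝 (f y))) (x : X) :
    Tendsto (fun n => (Qc G μ V).form (delta μ x) (u n)) atTop
      (𝓝 (μ x * formalOperator G μ V f x)) := by
  have hfd := mem_formalDomain_of_tendsto hC hu hf
  rw [mul_formalOperator G V hfd]
  simp only [Qc_form_delta]
  refine ((hf x).const_mul _).sub ?_
  have hs : ∀ g ∈ formalDomain G, Summable fun y => (G.b x y : ℂ) * g y := fun g hg =>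
    Summable.of_norm ((hg x).congr fun y => by
      rw [norm_mul, Complex.norm_real, Real.norm_of_nonneg (G.nonneg _ _)])
  rw [Metric.tendsto_atTop]
  intro ε hε
  obtain ⟨N, hN⟩ := edge_sum_sub_le hC hu hf x (half_pos hε)
  refine ⟨N, fun n hn => ?_⟩
  obtain ⟨h1, h2⟩ := hN n hn
  rw [dist_eq_norm,
    ← (hs _ (mem_formalDomain_of_finite G (support_finite (u n)))).tsum_sub (hs f hfd)]
  have h3 : ∀ y, ‖(G.b x y : ℂ) * (u n : L2 μ) y - (G.b x y : ℂ) * f y‖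
      = G.b x y * ‖(u n : L2 μ) y - f y‖ := fun y => by
    rw [← mul_sub, norm_mul, Complex.norm_real, Real.norm_of_nonneg (G.nonneg _ _)]
  refine (norm_tsum_le_tsum_norm (by simpa only [h3] using h1)).trans_lt ?_
  simp only [h3]
  linarith

/-! ### Closability, the associated operator and the Beurling–Deny criterion -/

instance [Nonempty X] : Nontrivial (finSupp μ) :=
  ⟨delta μ (Classical.arbitrary X), 0, delta_ne_zero _⟩

/-- The limit function is 0, on which the formal operator vanishes, so the form tends to zero
against each $\delta_x$ and, by linearity, against `f`. -/
theorem tendsto_inner_of_zero {u : ℕ → finSupp μ} (hu : CauchySeq fun n => ofFinSupp hC (u n))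
    (h0 : Tendsto (fun n => (u n : L2 μ)) atTop (𝓝 0)) (f : finSupp μ) :
    Tendsto (fun n => inner ℂ (ofFinSupp hC f) (ofFinSupp hC (u n))) atTop (𝓝 0) := by
  have hx : ∀ x, Tendsto (fun n => (Qc G μ V).form (delta μ x) (u n)) atTop (𝓝 0) := by
    intro x
    have h := tendsto_Qc_form_delta hC hu (f := fun _ => 0) (L2.tendsto_apply h0) x
    simpa [formalOperator] using h
  have hf : Tendsto (fun n => (Qc G μ V).form f (u n)) atTop (𝓝 0) := by
    rw [eq_sum_delta f]
    have e : ∀ n, (Qc G μ V).form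
        (∑ x ∈ (support_finite f).toFinset, (f : L2 μ) x • delta μ x : finSupp μ) (u n)
        = ∑ x ∈ (support_finite f).toFinset,
          conj ((f : L2 μ) x) * (Qc G μ V).form (delta μ x) (u n) := fun n => by
      have h1 := map_sum ((Qc G μ V).form.flip (u n)) (fun x => (f : L2 μ) x • delta μ x)
        (support_finite f).toFinset
      refine h1.trans (Finset.sum_congr rfl fun x _ => ?_)
      exact LinearMap.map_smulₛₗ ((Qc G μ V).form.flip (u n)) _ _
    simp only [e]
    simpa using tendsto_finsetSum (support_finite f).toFinset
      fun x _ => (hx x).const_mul (conj ((f : L2 μ) x))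
  simp only [inner_ofFinSupp]
  simpa using hf.add ((tendsto_const_nhds.inner h0).const_mul ((1 - C : ℝ) : ℂ))

theorem exists_isClosureOf_Qc [Nonempty X] (hV : IsAdmissible G μ V) : ∃ q : HermForm (L2 μ), q.IsClosureOf (Qc G μ V) := by
  obtain ⟨C, hC⟩ := hV
  have : Nontrivial (Qc G μ V).domain := inferInstanceAs (Nontrivial (finSupp μ))
  exact exists_isClosureOf (q := Qc G μ V) dense_finSupp hC fun u hu h0 f =>
    tendsto_inner_of_zero hC hu h0 f

theorem isClosureOf_Q0 [Nonempty X] (hV : IsAdmissible G μ V) : (Q0 G μ V).IsClosureOf (Qc G μ V) := by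
  have h := exists_isClosureOf_Qc hV
  rw [Q0, HermForm.closure, dif_pos h]
  exact h.choose_spec

theorem nontrivial_domain [Nonempty X] {q : HermForm (L2 μ)} (hq : q.IsExtensionOf (Qc G μ V)) :
    Nontrivial q.domain := by
  obtain ⟨hle, -⟩ := hq
  exact (Submodule.inclusion_injective (p := finSupp μ) hle).nontrivial

/-- Elements of the domain of a closure of `𝓠ᶜ` are approximated by finitely supported
functions. -/
theorem exists_tendsto_of_isClosureOf {q : HermForm (L2 μ)} (hq : q.IsClosureOf (Qc G μ V))
    (hle : finSupp μ ≤ q.domain) [Nontrivial q.domain] (hC : q.IsLowerBound C) (f : q.domain) :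
    ∃ u : ℕ → finSupp μ,
      Tendsto (fun n => of hC (Submodule.inclusion hle (u n))) atTop (𝓝 (of hC f)) := by
  obtain ⟨v, hv, hvf⟩ := hq.form_dense f
  exact ⟨fun n => ⟨v n, hv n⟩, (tendsto_formNormSq_iff hC).1 hvf⟩

/-- The operator associated with a closure of `𝓠ᶜ` is a restriction of `𝓗`. -/
theorem formalOperator_of_mem_operatorGraph [Nonempty X] {q : HermForm (L2 μ)}
    (hq : q.IsClosureOf (Qc G μ V)) {f g : L2 μ} (hfg : (f, g) ∈ q.operatorGraph) :
    (f : X → ℂ) ∈ formalDomain G ∧ ∀ x, g x = formalOperator G μ V f x := by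
  have := nontrivial_domain hq.extension
  obtain ⟨hle, hext⟩ := hq.extension
  change finSupp μ ≤ q.domain at hle
  replace hext : ∀ f g : finSupp μ, q.form (Submodule.inclusion hle f) (Submodule.inclusion hle g)
      = (Qc G μ V).form f g := hext
  obtain ⟨C, hC⟩ := hq.closed.lowerSemibounded
  obtain ⟨hf, hg⟩ := hfg
  -- Using the same `C` for both forms makes their form norms agree on $C_c(X)$, so Cauchy sequences
  -- transfer.
  have hC' : (Qc G μ V).IsLowerBound C := fun u => by
    refine (hC (Submodule.inclusion hle u)).trans_eq ?_
    exact congrArg Complex.re (hext u u)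
  have hinner : ∀ u v : finSupp μ, inner ℂ (of hC (Submodule.inclusion hle u))
      (of hC (Submodule.inclusion hle v)) = inner ℂ (ofFinSupp hC' u) (ofFinSupp hC' v) :=
    fun u v => by
      rw [inner_of, inner_ofFinSupp, hext]
      rfl
  have hnorm : ∀ u : finSupp μ, ‖of hC (Submodule.inclusion hle u)‖ = ‖ofFinSupp hC' u‖ :=
    fun u => by
      rw [@norm_eq_sqrt_re_inner ℂ, @norm_eq_sqrt_re_inner ℂ, hinner]
  obtain ⟨u, hu⟩ := exists_tendsto_of_isClosureOf hq hle hC ⟨f, hf⟩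
  have hcau : CauchySeq fun n => ofFinSupp hC' (u n) := by
    have h := hu.cauchySeq
    rw [Metric.cauchySeq_iff] at h ⊢
    simpa only [dist_eq_norm, ← map_sub, hnorm] using h
  have hL2 : Tendsto (fun n => (u n : L2 μ)) atTop (𝓝 f) :=
    ((incl hC).continuous.tendsto _).comp hu
  have hpt := L2.tendsto_apply hL2
  refine ⟨mem_formalDomain_of_tendsto hC' hcau hpt, fun x => ?_⟩
  -- The form is the form-space inner product minus a multiple of the ambient one, and both
  -- converge.
  have hlim : Tendsto (fun n => (Qc G μ V).form (delta μ x) (u n)) atTop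
      (𝓝 (q.form (Submodule.inclusion hle (delta μ x)) ⟨f, hf⟩)) := by
    have h1 : Tendsto (fun n => inner ℂ (of hC (Submodule.inclusion hle (delta μ x)))
        (of hC (Submodule.inclusion hle (u n))) - ((1 - C : ℝ) : ℂ) *
          inner ℂ (delta μ x : L2 μ) (u n : L2 μ)) atTop (𝓝 _) :=
      (tendsto_const_nhds.inner hu).sub ((tendsto_const_nhds.inner hL2).const_mul _)
    simp only [hinner, inner_ofFinSupp] at h1
    rw [inner_of] at h1
    simpa using h1
  have heq := tendsto_nhds_unique hlim (tendsto_Qc_form_delta hC' hcau hpt x)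
  have h2 : inner ℂ (delta μ x : L2 μ) g = μ x * formalOperator G μ V f x := by
    rw [← heq, ← q.conj_form, hg]
    exact (inner_conj_symm _ _).symm
  rw [inner_delta, mul_comm] at h2
  exact mul_left_cancel₀ (by exact_mod_cast (μ.pos x).ne') h2

/-- A closure of `𝓠ᶜ` satisfies the first Beurling-Deny criterion. -/
theorem firstBeurlingDeny_of_isClosureOf [Nonempty X] {q : HermForm (L2 μ)}
    (hq : q.IsClosureOf (Qc G μ V)) : FirstBeurlingDeny q := by
  have := nontrivial_domain hq.extension
  obtain ⟨hle, hext⟩ := hq.extension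
  change finSupp μ ≤ q.domain at hle
  have hquad : ∀ u : finSupp μ, q.quad (Submodule.inclusion hle u) = (Qc G μ V).quad u :=
    fun u => congrArg Complex.re (hext u u)
  obtain ⟨C, hC⟩ := hq.closed.lowerSemibounded
  intro f
  obtain ⟨u, hu⟩ := exists_tendsto_of_isClosureOf hq hle hC f
  have hL2 : Tendsto (fun n => (u n : L2 μ)) atTop (𝓝 (f : L2 μ)) :=
    ((incl hC).continuous.tendsto _).comp hu
  have hq' : Tendsto (fun n => q.quad (Submodule.inclusion hle (u n))) atTop (𝓝 (q.quad f)) := by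
    have h := (hu.norm.pow 2).sub ((hL2.norm.pow 2).const_mul (1 - C))
    simpa only [norm_sq_of, Submodule.coe_inclusion, add_sub_cancel_right] using h
  -- The `|u n|` converge to `|f|` in $\ell^2$, and their energies are at most those of `u n`, which
  -- tend to `q.quad f`.
  refine quad_le_of_tendsto hq.closed (u := fun n => Submodule.inclusion hle (absFinSupp (u n)))
    (L2.tendsto_abs hL2) hq' fun n => ?_
  rw [hquad, hquad]
  exact quad_abs_le G V (u n)

theorem isRealization_operator [Nonempty X] {q : HermForm (L2 μ)} (hq : q.IsClosureOf (Qc G μ V)) :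
    IsRealization G μ V q.operator := by
  have := nontrivial_domain hq.extension
  refine ⟨isSelfAdjoint_operator hq.closed, operator_semibounded hq.closed,
    ⟨q, hq.closed, rfl, hq.extension.1⟩, fun f => ?_⟩
  exact formalOperator_of_mem_operatorGraph hq (mem_operatorGraph hq.closed f)

end

end DiscreteSchrodinger

end

theorem mainTheorem2 {X : Type*} [Countable X] [Nonempty X]
    (G : DiscreteSchrodinger.WeightedGraph X) (μ : DiscreteSchrodinger.Weight X) (V : X → ℝ)
    (hV : DiscreteSchrodinger.IsAdmissible G μ V) :
    (DiscreteSchrodinger.Qc G μ V).IsLowerSemibounded ∧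
    (DiscreteSchrodinger.Qc G μ V).IsClosable ∧
    (DiscreteSchrodinger.Q0 G μ V).IsClosureOf (DiscreteSchrodinger.Qc G μ V) ∧
    DiscreteSchrodinger.IsRealization G μ V (DiscreteSchrodinger.H0 G μ V) ∧
    DiscreteSchrodinger.FirstBeurlingDeny (DiscreteSchrodinger.Q0 G μ V) := by
  have h := DiscreteSchrodinger.isClosureOf_Q0 hV
  exact ⟨hV, ⟨_, h.closed, h.extension⟩, h, DiscreteSchrodinger.isRealization_operator h,
    DiscreteSchrodinger.firstBeurlingDeny_of_isClosureOf h⟩
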